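/- Let $\ell\ge 0$ be an integer, let $\mathbb{C}_+=\{z\in\mathbb{C}:\operatorname{Re} z>0\}$, and let $A^2_\ell$ be the weighted Bergman space of all analytic functions $h:\mathbb{C}_+\to\mathbb{C}$ with $$\|h\|^2=\frac1\pi\int_{-\infty}^{\infty}\int_0^\infty x^\ell\,|h(x+iy)|^2\,dx\,dy<\infty .$$ For $g:\mathbb{C}_+\to\mathbb{C}_+$ analytic, let $C_{g,\max}$ be the maximal composition operator: its domain is $\{h\in A^2_\ell: h\circ g\in A^2_\ell\}$, and $C_{g,\max}h=h\circ g$. It is called bounded if its domain is all of $A^2_\ell$ and there is $L>0$ with $\|C_{g,\max}h\|\le L\|h\|$ for all $h\in A^2_\ell$. A conjugation is a conjugate-linear isometric involution $\mathcal{C}$ of $A^2_\ell$, and a (possibly unbounded) linear operator $B$ on $A^2_\ell$ is called complex symmetric if there is a conjugation $\mathcal{C}$ such that $B=\mathcal{C}B^*\mathcal{C}$ (equality of domains included). (1) Let $g$ be an analytic self-map of $\mathbb{C}_+$, different from the identity map, such that $C_{g,\max}$ is bounded on $A^2_\ell$. If $g$ has a fixed point in $\mathbb{C}_+$, then $C_{g,\max}$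 is not complex symmetric, that is, there is no conjugation $\mathcal{C}$ on $A^2_\ell$ with $C_{g,\max}=\mathcal{C}\,C_{g,\max}^*\,\mathcal{C}$. (2) If $g(w)=\mu w+w_0$ with $\mu\in(0,\infty)$, $\mu\neq 1$, and $\operatorname{Re} w_0>0$, then $C_{g,\max}$ is not complex symmetric. -/

import Mathlib

open MeasureTheory
open scoped ComplexConjugate

noncomputable section

namespace HalfPlane

/-- The open right half-plane `{z : Re z > 0}`, as a subtype of `ℂ`. -/
abbrev RHP : Type := {z : ℂ // 0 < z.re}

/-- A function on the right half-plane is analytic if it is complex differentiable there;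
it is extended by zero to `ℂ` only in order to speak of complex derivatives. -/
def IsAnalytic (f : RHP → ℂ) : Prop :=
  DifferentiableOn ℂ (Function.extend Subtype.val f 0) {z : ℂ | 0 < z.re}

lemma extend_apply (f : RHP → ℂ) (z : RHP) :
    Function.extend Subtype.val f 0 (z : ℂ) = f z :=
  Subtype.val_injective.extend_apply f 0 z

lemma isAnalytic_iff_exists (f : RHP → ℂ) :
    IsAnalytic f ↔ ∃ F : ℂ → ℂ, DifferentiableOn ℂ F {z : ℂ | 0 < z.re} ∧ ∀ z : RHP, F z = f z :=
  ⟨fun h => ⟨_, h, extend_apply f⟩, fun ⟨_, hF, h⟩ =>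
    hF.congr fun z hz => (extend_apply f ⟨z, hz⟩).trans (h ⟨z, hz⟩).symm⟩

lemma IsAnalytic.add {f g : RHP → ℂ} (hf : IsAnalytic f) (hg : IsAnalytic g) :
    IsAnalytic (f + g) := by
  rw [isAnalytic_iff_exists] at *
  obtain ⟨F, hF, h1⟩ := hf
  obtain ⟨G, hG, h2⟩ := hg
  exact ⟨F + G, hF.add hG, fun z => by simp [h1, h2]⟩

lemma IsAnalytic.smul (c : ℂ) {f : RHP → ℂ} (hf : IsAnalytic f) : IsAnalytic (c • f) := by
  rw [isAnalytic_iff_exists] at *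
  obtain ⟨F, hF, h1⟩ := hf
  exact ⟨c • F, hF.const_smul c, fun z => by simp [h1]⟩

lemma IsAnalytic.zero : IsAnalytic 0 :=
  (isAnalytic_iff_exists 0).2 ⟨0, differentiableOn_const 0, fun _ => rfl⟩

lemma IsAnalytic.continuous {f : RHP → ℂ} (hf : IsAnalytic f) : Continuous f := by
  have h : Continuous fun z : RHP => Function.extend Subtype.val f 0 (z : ℂ) :=
    continuousOn_iff_continuous_domRestrict.1 hf.continuousOn
  simpa only [extend_apply] using h

/-- Lebesgue measure `dx dy` on the right half-plane. -/
def lebesgue : Measure RHP := (volume : Measure ℂ).comap Subtype.val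

/-- The measure `(1 / π) x ^ ℓ dx dy`, `z = x + i y`, on the right half-plane. -/
def bergmanMeasure (ℓ : ℕ) : Measure RHP :=
  lebesgue.withDensity fun z => ENNReal.ofReal ((z : ℂ).re ^ ℓ / Real.pi)

/-- The set of analytic functions on the right half-plane that are square integrable
with respect to `bergmanMeasure ℓ`, as a linear subspace of the space of all functions. -/
def bergmanSubmodule (ℓ : ℕ) : Submodule ℂ (RHP → ℂ) where
  carrier := {h | IsAnalytic h ∧ MemLp h 2 (bergmanMeasure ℓ)}
  zero_mem' := ⟨IsAnalytic.zero, MemLp.zero⟩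
  add_mem' ha hb := ⟨ha.1.add hb.1, ha.2.add hb.2⟩
  smul_mem' c _ ha := ⟨ha.1.smul c, ha.2.const_smul c⟩

/-- The weighted Bergman space `A²_ℓ` of the right half-plane. (A separate type, so that it
carries the topology of its norm and not the one of pointwise convergence.) -/
def BergmanSpace (ℓ : ℕ) : Type := bergmanSubmodule ℓ

namespace BergmanSpace

variable {ℓ : ℕ}

instance : AddCommGroup (BergmanSpace ℓ) := inferInstanceAs (AddCommGroup (bergmanSubmodule ℓ))

instance : Module ℂ (BergmanSpace ℓ) := inferInstanceAs (Module ℂ (bergmanSubmodule ℓ))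

/-- The linear map that sends an element of the Bergman space to the underlying function. -/
def toFun (ℓ : ℕ) : BergmanSpace ℓ →ₗ[ℂ] (RHP → ℂ) := (bergmanSubmodule ℓ).subtype

instance : CoeFun (BergmanSpace ℓ) fun _ => RHP → ℂ := ⟨fun h => toFun ℓ h⟩

lemma coe_mem (h : BergmanSpace ℓ) : (h : RHP → ℂ) ∈ bergmanSubmodule ℓ := Subtype.property h

lemma coe_injective : Function.Injective (toFun ℓ) := Subtype.val_injective

lemma integrable_conj_mul (f g : BergmanSpace ℓ) :
    Integrable (fun z => conj (f z) * g z) (bergmanMeasure ℓ) :=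
  f.coe_mem.2.star.integrable_mul g.coe_mem.2

instance : lebesgue.IsOpenPosMeasure :=
  have h : IsOpen {z : ℂ | 0 < z.re} := isOpen_lt continuous_const Complex.continuous_re
  Measure.IsOpenPosMeasure.comap volume h.isOpenEmbedding_subtypeVal

lemma eq_zero_of_ae {h : RHP → ℂ} (hc : Continuous h) (h0 : h =ᵐ[bergmanMeasure ℓ] 0) : h = 0 := by
  have hac : lebesgue ≪ bergmanMeasure ℓ := by
    refine withDensity_absolutelyContinuous' ?_ (.of_forall fun z => ?_)
    · exact (by fun_prop : Measurable fun z : RHP =>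
        ENNReal.ofReal ((z : ℂ).re ^ ℓ / Real.pi)).aemeasurable
    · exact (ENNReal.ofReal_pos.2 (div_pos (pow_pos z.2 ℓ) Real.pi_pos)).ne'
  exact (hc.ae_eq_iff_eq lebesgue continuous_const).1 (hac.ae_eq h0)

/-- The inner product `⟪f, g⟫ = (1 / π) ∫∫ x ^ ℓ conj (f (x + i y)) g (x + i y) dx dy`
(conjugate linear in the first variable). -/
abbrev innerCore (ℓ : ℕ) : InnerProductSpace.Core ℂ (BergmanSpace ℓ) where
  inner f g := ∫ z, conj (f z) * g z ∂bergmanMeasure ℓ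
  conj_inner_symm f g := by
    rw [← integral_conj]
    simp [mul_comm]
  re_inner_nonneg f := by
    have h : ∀ z, conj (f z) * f z = ((‖f z‖ ^ 2 : ℝ) : ℂ) := fun z => by
      simp [Complex.conj_mul']
    simp_rw [h, integral_complex_ofReal]
    simpa using integral_nonneg fun z => sq_nonneg ‖f z‖
  add_left f g h := by
    rw [← integral_add (integrable_conj_mul f h) (integrable_conj_mul g h)]
    simp [add_mul]
  smul_left f g c := by
    rw [← integral_const_mul]
    simp [mul_assoc]
  definite f hf := by
    have h : ∀ z, conj (f z) * f z = ((‖f z‖ ^ 2 : ℝ) : ℂ) := fun z => by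
      simp [Complex.conj_mul']
    have hi : Integrable (fun z => ‖f z‖ ^ 2) (bergmanMeasure ℓ) := by
      have := (integrable_conj_mul f f).re
      simpa only [h, RCLike.re_to_complex, Complex.ofReal_re] using this
    simp_rw [h, integral_complex_ofReal, Complex.ofReal_eq_zero] at hf
    rw [integral_eq_zero_iff_of_nonneg (fun z => sq_nonneg _) hi] at hf
    refine coe_injective (eq_zero_of_ae (ℓ := ℓ) f.coe_mem.1.continuous ?_)
    filter_upwards [hf] with z hz
    simpa using hz

instance : NormedAddCommGroup (BergmanSpace ℓ) := (innerCore ℓ).toNormedAddCommGroup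

instance : InnerProductSpace ℂ (BergmanSpace ℓ) := InnerProductSpace.ofCore (innerCore ℓ).toCore

end BergmanSpace

/-- The maximal composition operator `C_{g,max} : h ↦ h ∘ g` on `A²_ℓ`, with domain
`{h ∈ A²_ℓ : h ∘ g ∈ A²_ℓ}`. -/
def maxCompositionOperator (ℓ : ℕ) (g : RHP → RHP) : BergmanSpace ℓ →ₗ.[ℂ] BergmanSpace ℓ where
  domain := (bergmanSubmodule ℓ).comap (LinearMap.funLeft ℂ ℂ g ∘ₗ BergmanSpace.toFun ℓ)
  toFun := (LinearMap.funLeft ℂ ℂ g ∘ₗ BergmanSpace.toFun ℓ).restrict fun _ h => h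

lemma mem_maxCompositionOperator_domain {ℓ : ℕ} {g : RHP → RHP} {h : BergmanSpace ℓ} :
    h ∈ (maxCompositionOperator ℓ g).domain ↔
      (fun w => h (g w)) ∈ bergmanSubmodule ℓ := Iff.rfl

lemma maxCompositionOperator_apply {ℓ : ℕ} {g : RHP → RHP}
    (h : (maxCompositionOperator ℓ g).domain) (w : RHP) :
    maxCompositionOperator ℓ g h w = (h : BergmanSpace ℓ) (g w) := rfl

section Operators

variable {E : Type*} [NormedAddCommGroup E] [InnerProductSpace ℂ E]

/-- A linear operator `B` with domain in `E` is bounded on `E` if it is everywhere defined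
and `‖B x‖ ≤ L ‖x‖` for some `L > 0` and all `x`. -/
def IsBoundedOn (B : E →ₗ.[ℂ] E) : Prop :=
  B.domain = ⊤ ∧ ∃ L : ℝ, 0 < L ∧ ∀ x : B.domain, ‖B x‖ ≤ L * ‖(x : E)‖

/-- A conjugation: a conjugate-linear isometry that is an involution. -/
def IsConjugation (C : E →ₗᵢ⋆[ℂ] E) : Prop := ∀ x, C (C x) = x

/-- `B = C B* C` as (possibly unbounded) operators, domains included: `x ∈ dom B` and `B x = y`
if and only if `C x ∈ dom B*` and `B* (C x) = C y`. The adjoint is taken on the level of graphs;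
if `B` is densely defined and `E` is complete this is the graph of the adjoint operator. -/
def IsComplexSymmetricWith (C : E →ₗᵢ⋆[ℂ] E) (B : E →ₗ.[ℂ] E) : Prop :=
  ∀ x y : E, (x, y) ∈ B.graph ↔ (C x, C y) ∈ B.graph.adjoint

/-- `B` is complex symmetric if `B = C B* C` for some conjugation `C`. -/
def IsComplexSymmetric (B : E →ₗ.[ℂ] E) : Prop :=
  ∃ C : E →ₗᵢ⋆[ℂ] E, IsConjugation C ∧ IsComplexSymmetricWith C B

end Operators

end HalfPlane

end

/-! The proof rests on the reproducing kernels K_w(z) = 2^ℓ (ℓ+1) / (z + conj w)^(ℓ+2). The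
reproducing property (`inner_kernel`) gives B* K_w = K_{g(w)} for B = C_{g,max}. If g fixes α, then
K_α is fixed by B*, so B = C B* C makes C K_α a nonzero function invariant under composition with g
(`conjugation_kernel_comp_eq`).

If α is attracting, iterating g near α and the identity theorem make such a function constant
(`eq_of_comp_eq_of_norm_deriv_lt_one`), hence zero, since the half-plane has infinite measure. If α
is not attracting, the Schwarz lemma makes g a rotation about α. When g is not the identity, K_α ∘ g
stays away from 0 near infinity and leaves the space (`kernel_comp_not_mem_of_diskMap_eq_mul`), so B
is not everywhere defined.

For g(w) = μ w + w₀ with μ < 1 there is an attracting fixed point in the half-plane. For μ > 1 the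
roles of B and B* are exchanged: B K_w is a multiple of K_{σ(w)} with σ(w) = (w + conj w₀) / μ, and
σ is a contraction with a fixed point β. Then C K_β is an eigenvector of B*, and pairing with
kernels shows that it is σ-invariant. Adjoints enter only through graphs, so completeness plays no
role. -/

namespace HalfPlane

open Metric Set Filter Topology

/-! ### Weighted mean value property on the disk -/

section DiskMeanValue

lemma integral_mul_one_sub_sq_pow (ℓ : ℕ) :
    ∫ r in (0 : ℝ)..1, r * (1 - r ^ 2) ^ ℓ = 1 / (2 * ((ℓ : ℝ) + 1)) := by
  have hd : ∀ r ∈ uIcc (0 : ℝ) 1, HasDerivAt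
      (fun r : ℝ => -(1 / (2 * ((ℓ : ℝ) + 1))) * (1 - r ^ 2) ^ (ℓ + 1)) (r * (1 - r ^ 2) ^ ℓ) r := by
    intro r _
    have h := (((hasDerivAt_id' r).fun_pow 2).const_sub 1).fun_pow (ℓ + 1)
    refine (h.const_mul (-(1 / (2 * ((ℓ : ℝ) + 1))))).congr_deriv ?_
    push_cast
    simp
    field_simp
  rw [intervalIntegral.integral_eq_sub_of_hasDerivAt hd
    (Continuous.intervalIntegrable (by fun_prop) _ _)]
  simp

/-- Radially weighted mean value property of analytic functions on the unit disk. -/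
lemma setIntegral_ball_one_sub_sq_pow_smul (ℓ : ℕ) {G : ℂ → ℂ}
    (hG : DifferentiableOn ℂ G (ball 0 1))
    (hi : IntegrableOn (fun ζ : ℂ => ((1 - ‖ζ‖ ^ 2) ^ ℓ : ℝ) • G ζ) (ball 0 1)) :
    ∫ ζ in ball (0 : ℂ) 1, ((1 - ‖ζ‖ ^ 2) ^ ℓ : ℝ) • G ζ = (Real.pi / (ℓ + 1) : ℝ) • G 0 := by
  -- Extension by zero allows polar coordinates on all of ℂ.
  set F : ℂ → ℂ := (ball (0 : ℂ) 1).indicator (fun ζ : ℂ => ((1 - ‖ζ‖ ^ 2) ^ ℓ : ℝ) • G ζ) with hF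
  have hFm : Measurable F := by
    classical
    have hc : ContinuousOn (fun ζ : ℂ => ((1 - ‖ζ‖ ^ 2) ^ ℓ : ℝ) • G ζ) (ball 0 1) :=
      ContinuousOn.smul (f := fun ζ : ℂ => (1 - ‖ζ‖ ^ 2) ^ ℓ) (by fun_prop) hG.continuousOn
    rw [hF, ← piecewise_eq_indicator]
    exact hc.measurable_piecewise continuousOn_const measurableSet_ball
  have hFi : Integrable F := (integrable_indicator_iff measurableSet_ball).2 hi
  have hcs : Continuous fun p : ℝ × ℝ => Complex.polarCoord.symm p := by
    simp only [Complex.polarCoord_symm_apply]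
    fun_prop
  -- Fubini needs joint integrability in (r, θ); it follows from that of F by the polar change of
  -- variables for the norm.
  have hpi : IntegrableOn (fun p : ℝ × ℝ => p.1 • F (Complex.polarCoord.symm p))
      (Ioi 0 ×ˢ Ioo (-Real.pi) Real.pi) := by
    refine ⟨(measurable_fst.smul (hFm.comp hcs.measurable)).aestronglyMeasurable, ?_⟩
    have h := Complex.lintegral_comp_polarCoord_symm fun z => ‖F z‖ₑ
    have h2 := hFi.2
    rw [HasFiniteIntegral, ← h, polarCoord_target] at h2
    refine lt_of_le_of_lt (setLIntegral_mono' (by measurability) fun p hp => ?_) h2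
    rw [enorm_smul, smul_eq_mul, Real.enorm_eq_ofReal (le_of_lt hp.1)]
  have hinner : ∀ r ∈ Ioi (0 : ℝ), ∫ θ in Ioo (-Real.pi) Real.pi,
      r • F (Complex.polarCoord.symm (r, θ)) =
      (Iio (1 : ℝ)).indicator (fun r => (r * (1 - r ^ 2) ^ ℓ) • ((2 * Real.pi) • G 0)) r := by
    intro r hr
    rw [mem_Ioi] at hr
    have hn : ∀ θ : ℝ, ‖Complex.polarCoord.symm (r, θ)‖ = r := fun θ => by
      rw [Complex.norm_polarCoord_symm, abs_of_pos hr]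
    by_cases hr1 : r < 1
    · have h1 : ∀ θ : ℝ, r • F (Complex.polarCoord.symm (r, θ)) =
          (r * (1 - r ^ 2) ^ ℓ) • G (circleMap 0 r θ) := fun θ => by
        rw [hF, indicator_of_mem (by rw [mem_ball_zero_iff, hn]; exact hr1), hn, smul_smul]
        congr 2
        rw [Complex.polarCoord_symm_apply, circleMap, Complex.exp_mul_I]
        simp
      have hav : Real.circleAverage G 0 r = G 0 := by
        refine DiffContOnCl.circleAverage ?_
        rw [abs_of_pos hr]
        refine DifferentiableOn.diffContOnCl_ball (U := ball 0 1) hG ?_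
        exact closedBall_subset_ball hr1
      rw [indicator_of_mem (mem_Iio.2 hr1)]
      simp_rw [h1]
      -- The circle average is taken over an interval starting at -π to match the angular range of
      -- polar coordinates.
      rw [integral_smul, ← hav, Real.circleAverage_eq_integral_add (-Real.pi),
        smul_inv_smul₀ (by positivity),
        intervalIntegral.integral_comp_add_right (fun θ => G (circleMap 0 r θ)),
        ← integral_Ioc_eq_integral_Ioo,
        ← intervalIntegral.integral_of_le (by linarith [Real.pi_pos])]
      congr 2 <;> ring
    · rw [indicator_of_notMem (mt mem_Iio.1 hr1)]
      have h1 : ∀ θ : ℝ, r • F (Complex.polarCoord.symm (r, θ)) = 0 := fun θ => by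
        rw [hF, indicator_of_notMem (by rw [mem_ball_zero_iff, hn]; exact hr1), smul_zero]
      simp only [h1, integral_zero]
  rw [← integral_indicator measurableSet_ball, ← hF, ← Complex.integral_comp_polarCoord_symm,
    polarCoord_target, Measure.volume_eq_prod, setIntegral_prod _ hpi,
    setIntegral_congr_fun measurableSet_Ioi hinner, setIntegral_indicator measurableSet_Iio,
    Ioi_inter_Iio, integral_smul_const, ← integral_Ioc_eq_integral_Ioo,
    ← intervalIntegral.integral_of_le zero_le_one, integral_mul_one_sub_sq_pow, smul_smul]
  congr 1
  field_simp

end DiskMeanValue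

/-! ### Cayley transform and change of variables -/

section Cayley

/-- The Möbius map from the unit disk onto the right half-plane that sends `0` to `w`. -/
noncomputable def cayley (w ζ : ℂ) : ℂ := (w + conj w * ζ) / (1 - ζ)

/-- The Möbius map from the right half-plane onto the unit disk that sends `w` to `0`. -/
noncomputable def cayleyInv (w z : ℂ) : ℂ := (z - w) / (z + conj w)

variable {w z ζ : ℂ}

lemma add_conj_ne_zero (hw : 0 < w.re) (hz : 0 < z.re) : z + conj w ≠ 0 := fun h => by
  have := congrArg Complex.re h
  simp at this
  linarith

lemma one_sub_ne_zero_of_mem_ball (hζ : ζ ∈ ball (0 : ℂ) 1) : 1 - ζ ≠ 0 := fun h => by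
  rw [← sub_eq_zero.1 h] at hζ
  simp at hζ

lemma cayley_zero (w : ℂ) : cayley w 0 = w := by simp [cayley]

lemma cayleyInv_self (w : ℂ) : cayleyInv w w = 0 := by simp [cayleyInv]

lemma re_cayley (w ζ : ℂ) : (cayley w ζ).re = w.re * (1 - ‖ζ‖ ^ 2) / ‖1 - ζ‖ ^ 2 := by
  rw [cayley, Complex.div_re, ← Complex.normSq_eq_norm_sq, ← Complex.normSq_eq_norm_sq, ← add_div]
  congr 1
  simp [Complex.normSq_apply]
  ring

lemma re_cayley_pos (hw : 0 < w.re) (hζ : ζ ∈ ball (0 : ℂ) 1) : 0 < (cayley w ζ).re := by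
  rw [re_cayley]
  have h1 := norm_pos_iff.2 (one_sub_ne_zero_of_mem_ball hζ)
  rw [mem_ball_zero_iff] at hζ
  have : 0 < 1 - ‖ζ‖ ^ 2 := by nlinarith [norm_nonneg ζ]
  positivity

lemma cayley_add_conj (w : ℂ) (hζ : ζ ∈ ball (0 : ℂ) 1) :
    cayley w ζ + conj w = (2 * w.re : ℝ) / (1 - ζ) := by
  rw [cayley, ← Complex.add_conj, div_add' _ _ _ (one_sub_ne_zero_of_mem_ball hζ)]
  ring

lemma cayleyInv_mem_ball (hw : 0 < w.re) (hz : 0 < z.re) : cayleyInv w z ∈ ball (0 : ℂ) 1 := by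
  rw [mem_ball_zero_iff, cayleyInv, norm_div,
    div_lt_one (norm_pos_iff.2 (add_conj_ne_zero hw hz))]
  refine lt_of_pow_lt_pow_left₀ 2 (norm_nonneg _) ?_
  rw [← Complex.normSq_eq_norm_sq, ← Complex.normSq_eq_norm_sq, Complex.normSq_apply,
    Complex.normSq_apply]
  simp
  nlinarith [mul_pos hw hz]

lemma two_re_ne_zero (hw : 0 < w.re) : w + conj w ≠ 0 := add_conj_ne_zero hw hw

lemma cayley_cayleyInv (hw : 0 < w.re) (hz : 0 < z.re) : cayley w (cayleyInv w z) = z := by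
  have h1 := add_conj_ne_zero hw hz
  have h2 : 1 - cayleyInv w z = (w + conj w) / (z + conj w) := by
    rw [cayleyInv]
    field_simp
    ring
  rw [cayley, h2, cayleyInv, div_eq_iff (div_ne_zero (two_re_ne_zero hw) h1)]
  field_simp
  ring

lemma cayleyInv_cayley (hw : 0 < w.re) (hζ : ζ ∈ ball (0 : ℂ) 1) :
    cayleyInv w (cayley w ζ) = ζ := by
  have h1 := one_sub_ne_zero_of_mem_ball hζ
  have h2 := two_re_ne_zero hw
  rw [cayleyInv, cayley_add_conj w hζ, ← Complex.add_conj, div_eq_iff (div_ne_zero h2 h1), cayley]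
  field_simp
  ring

lemma injOn_cayley (hw : 0 < w.re) : InjOn (cayley w) (ball 0 1) :=
  LeftInvOn.injOn fun _ hζ => cayleyInv_cayley hw hζ

lemma image_cayley (hw : 0 < w.re) : cayley w '' ball 0 1 = {z : ℂ | 0 < z.re} := by
  ext z
  constructor
  · rintro ⟨ζ, hζ, rfl⟩
    exact re_cayley_pos hw hζ
  · exact fun hz => ⟨_, cayleyInv_mem_ball hw hz, cayley_cayleyInv hw hz⟩

lemma hasDerivAt_cayley (w : ℂ) (hζ : ζ ∈ ball (0 : ℂ) 1) :
    HasDerivAt (cayley w) ((2 * w.re : ℝ) / (1 - ζ) ^ 2) ζ := by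
  have h := (((hasDerivAt_id' ζ).const_mul (conj w)).const_add w).fun_div
    ((hasDerivAt_id' ζ).const_sub 1) (one_sub_ne_zero_of_mem_ball hζ)
  refine h.congr_deriv ?_
  rw [← Complex.add_conj]
  ring

lemma differentiableOn_cayley (w : ℂ) : DifferentiableOn ℂ (cayley w) (ball 0 1) :=
  fun _ hζ => (hasDerivAt_cayley w hζ).differentiableAt.differentiableWithinAt

lemma differentiableOn_cayleyInv (hw : 0 < w.re) :
    DifferentiableOn ℂ (cayleyInv w) {z : ℂ | 0 < z.re} := fun _ hz =>
  (DifferentiableAt.fun_div (c := fun z => z - w) (d := fun z => z + conj w)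
    (differentiableAt_id.sub_const w) (differentiableAt_id.add_const (conj w))
    (add_conj_ne_zero hw hz)).differentiableWithinAt

/-- The real determinant of multiplication by a is the field norm of a from ℂ to ℝ. This is the
Jacobian of a holomorphic change of variables. -/
lemma abs_det_restrictScalars_toSpanSingleton (a : ℂ) :
    |((ContinuousLinearMap.toSpanSingleton ℂ a).restrictScalars ℝ).det| = ‖a‖ ^ 2 := by
  have : ((ContinuousLinearMap.toSpanSingleton ℂ a).restrictScalars ℝ).det = ‖a‖ ^ 2 := by
    rw [ContinuousLinearMap.det, ContinuousLinearMap.coe_restrictScalars,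
      LinearMap.det_restrictScalars]
    simp [Algebra.norm_complex_apply, Complex.normSq_eq_norm_sq]
  rw [this, abs_of_nonneg (by positivity)]

variable {E : Type*} [NormedAddCommGroup E] [NormedSpace ℝ E]

lemma norm_deriv_cayley_sq (w ζ : ℂ) :
    ‖((2 * w.re : ℝ) / (1 - ζ) ^ 2 : ℂ)‖ ^ 2 = (2 * w.re) ^ 2 / ‖1 - ζ‖ ^ 4 := by
  rw [norm_div, norm_pow, Complex.norm_real, div_pow, Real.norm_eq_abs, sq_abs, ← pow_mul]

lemma setIntegral_halfPlane_eq (hw : 0 < w.re) (f : ℂ → E) :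
    ∫ z in {z : ℂ | 0 < z.re}, f z =
      ∫ ζ in ball (0 : ℂ) 1, ((2 * w.re) ^ 2 / ‖1 - ζ‖ ^ 4) • f (cayley w ζ) := by
  rw [← image_cayley hw, integral_image_eq_integral_abs_det_fderiv_smul volume measurableSet_ball
    (fun ζ hζ => ((hasDerivAt_cayley w hζ).hasFDerivAt.restrictScalars ℝ).hasFDerivWithinAt)
    (injOn_cayley hw)]
  simp only [abs_det_restrictScalars_toSpanSingleton, norm_deriv_cayley_sq]

lemma integrableOn_halfPlane_iff (hw : 0 < w.re) (f : ℂ → E) :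
    IntegrableOn f {z : ℂ | 0 < z.re} ↔
      IntegrableOn (fun ζ => ((2 * w.re) ^ 2 / ‖1 - ζ‖ ^ 4) • f (cayley w ζ)) (ball 0 1) := by
  rw [← image_cayley hw, integrableOn_image_iff_integrableOn_abs_det_fderiv_smul volume
    measurableSet_ball
    (fun ζ hζ => ((hasDerivAt_cayley w hζ).hasFDerivAt.restrictScalars ℝ).hasFDerivWithinAt)
    (injOn_cayley hw)]
  simp only [abs_det_restrictScalars_toSpanSingleton, norm_deriv_cayley_sq]

end Cayley

end HalfPlane

namespace HalfPlane

open Metric Set Filter Topology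

/-! ### Bergman integrals in disk coordinates; infinite measure -/

section BergmanIntegral

variable {E : Type*} [NormedAddCommGroup E] {ℓ : ℕ}

lemma measurableSet_halfPlane : MeasurableSet {z : ℂ | 0 < z.re} :=
  measurableSet_lt measurable_const Complex.measurable_re

lemma measurableEmbedding_coe : MeasurableEmbedding (Subtype.val : RHP → ℂ) :=
  MeasurableEmbedding.subtype_coe measurableSet_halfPlane

lemma range_coe : range (Subtype.val : RHP → ℂ) = {z : ℂ | 0 < z.re} := Subtype.range_coe

lemma measurable_bergmanDensity (ℓ : ℕ) :
    Measurable fun z : RHP => ENNReal.ofReal ((z : ℂ).re ^ ℓ / Real.pi) := by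
  fun_prop

lemma toReal_bergmanDensity (ℓ : ℕ) (z : RHP) :
    (ENNReal.ofReal ((z : ℂ).re ^ ℓ / Real.pi)).toReal = (z : ℂ).re ^ ℓ / Real.pi :=
  ENNReal.toReal_ofReal (div_nonneg (pow_nonneg z.2.le ℓ) Real.pi_pos.le)

lemma integrable_lebesgue_iff (F : ℂ → E) :
    Integrable (fun z : RHP => F z) lebesgue ↔ IntegrableOn F {z : ℂ | 0 < z.re} := by
  have h := measurableEmbedding_coe.integrable_map_iff (μ := lebesgue) (g := F)
  rw [lebesgue, measurableEmbedding_coe.map_comap, range_coe] at h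
  exact h.symm

variable [NormedSpace ℝ E]

lemma integral_bergmanMeasure_eq (F : ℂ → E) :
    ∫ z : RHP, F z ∂bergmanMeasure ℓ =
      ∫ z in {z : ℂ | 0 < z.re}, (z.re ^ ℓ / Real.pi) • F z := by
  rw [bergmanMeasure, integral_withDensity_eq_integral_toReal_smul (measurable_bergmanDensity ℓ)
    (.of_forall fun _ => ENNReal.ofReal_lt_top)]
  simp_rw [toReal_bergmanDensity]
  exact integral_subtype_comap measurableSet_halfPlane
    fun z : ℂ => (z.re ^ ℓ / Real.pi) • F z

lemma integrable_bergmanMeasure_iff (F : ℂ → E) :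
    Integrable (fun z : RHP => F z) (bergmanMeasure ℓ) ↔
      IntegrableOn (fun z : ℂ => (z.re ^ ℓ / Real.pi) • F z) {z : ℂ | 0 < z.re} := by
  rw [bergmanMeasure, integrable_withDensity_iff_integrable_smul' (measurable_bergmanDensity ℓ)
    (.of_forall fun _ => ENNReal.ofReal_lt_top), ← integrable_lebesgue_iff]
  simp_rw [toReal_bergmanDensity]

/-- The density of `bergmanMeasure ℓ` in the coordinate `ζ` on the disk, `z = cayley w ζ`. -/
lemma bergmanDensity_cayley (ℓ : ℕ) {w ζ : ℂ} (hζ : ζ ∈ ball (0 : ℂ) 1) :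
    (2 * w.re) ^ 2 / ‖1 - ζ‖ ^ 4 * ((cayley w ζ).re ^ ℓ / Real.pi) =
      4 * w.re ^ (ℓ + 2) / Real.pi * ((1 - ‖ζ‖ ^ 2) ^ ℓ / ‖1 - ζ‖ ^ (2 * (ℓ + 2))) := by
  have h1 := norm_ne_zero_iff.2 (one_sub_ne_zero_of_mem_ball hζ)
  have h2 := Real.pi_ne_zero
  rw [re_cayley, div_pow, mul_pow, mul_pow]
  field_simp
  ring

lemma integral_bergmanMeasure_eq_ball (F : ℂ → E) {w : ℂ} (hw : 0 < w.re) :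
    ∫ z : RHP, F z ∂bergmanMeasure ℓ =
      ∫ ζ in ball (0 : ℂ) 1, (4 * w.re ^ (ℓ + 2) / Real.pi *
        ((1 - ‖ζ‖ ^ 2) ^ ℓ / ‖1 - ζ‖ ^ (2 * (ℓ + 2)))) • F (cayley w ζ) := by
  rw [integral_bergmanMeasure_eq, setIntegral_halfPlane_eq hw]
  refine setIntegral_congr_fun measurableSet_ball fun ζ hζ => ?_
  simp only [smul_smul]
  rw [bergmanDensity_cayley ℓ hζ]

lemma integrable_bergmanMeasure_iff_ball (F : ℂ → E) {w : ℂ} (hw : 0 < w.re) :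
    Integrable (fun z : RHP => F z) (bergmanMeasure ℓ) ↔
      IntegrableOn (fun ζ => (4 * w.re ^ (ℓ + 2) / Real.pi *
        ((1 - ‖ζ‖ ^ 2) ^ ℓ / ‖1 - ζ‖ ^ (2 * (ℓ + 2)))) • F (cayley w ζ)) (ball (0 : ℂ) 1) := by
  rw [integrable_bergmanMeasure_iff, integrableOn_halfPlane_iff hw]
  refine integrableOn_congr_fun (fun ζ hζ => ?_) measurableSet_ball
  simp only [smul_smul]
  rw [bergmanDensity_cayley ℓ hζ]

lemma lebesgue_setOf_le_re {R : ℝ} (hR : 0 < R) : lebesgue {z : RHP | R ≤ (z : ℂ).re} = ⊤ := by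
  have h1 : Subtype.val '' {z : RHP | R ≤ (z : ℂ).re} = {z : ℂ | R ≤ z.re} := by
    ext z
    constructor
    · rintro ⟨z, hz, rfl⟩
      exact hz
    · exact fun hz => ⟨⟨z, hR.trans_le hz⟩, hz, rfl⟩
  have h2 : {z : ℂ | R ≤ z.re} = Complex.measurableEquivRealProd ⁻¹' (Ici R ×ˢ univ) := by
    ext z
    simp [Complex.measurableEquivRealProd]
  rw [lebesgue, measurableEmbedding_coe.comap_apply, h1, h2,
    Complex.volume_preserving_equiv_real_prod.measure_preimage
      (measurableSet_Ici.prod MeasurableSet.univ).nullMeasurableSet,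
    Measure.volume_eq_prod, Measure.prod_prod]
  simp

lemma bergmanMeasure_setOf_le_re (ℓ : ℕ) {R : ℝ} (hR : 0 < R) :
    bergmanMeasure ℓ {z : RHP | R ≤ (z : ℂ).re} = ⊤ := by
  have hm : MeasurableSet {z : RHP | R ≤ (z : ℂ).re} :=
    measurableSet_le measurable_const (Complex.measurable_re.comp measurable_subtype_coe)
  rw [bergmanMeasure, withDensity_apply _ hm, eq_top_iff]
  calc (⊤ : ENNReal) = ∫⁻ _ in {z : RHP | R ≤ (z : ℂ).re},
        ENNReal.ofReal (R ^ ℓ / Real.pi) ∂lebesgue := by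
        rw [setLIntegral_const, lebesgue_setOf_le_re hR, ENNReal.mul_top]
        exact (ENNReal.ofReal_pos.2 (by positivity)).ne'
    _ ≤ _ := setLIntegral_mono (measurable_bergmanDensity ℓ) fun z hz =>
        ENNReal.ofReal_le_ofReal (by gcongr; exact hz)

/-- By Chebyshev, a square integrable function exceeds ε only on a set of finite measure, while
every {Re z ≥ R} has infinite measure. This excludes both nonzero constants and rotated kernels. -/
lemma not_memLp_of_le_norm {f : RHP → ℂ} {R ε : ℝ} (hR : 0 < R) (hε : 0 < ε)
    (hf : ∀ z : RHP, R ≤ (z : ℂ).re → ε ≤ ‖f z‖) : ¬ MemLp f 2 (bergmanMeasure ℓ) := fun h => by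
  have h1 := h.meas_ge_lt_top two_ne_zero ENNReal.ofNat_ne_top (ε := ⟨ε, hε.le⟩)
    (fun h0 => hε.ne' (congrArg NNReal.toReal h0))
  refine (h1.trans_le' (measure_mono (s := {z : RHP | R ≤ (z : ℂ).re}) fun z hz => hf z hz)).ne
    (bergmanMeasure_setOf_le_re ℓ hR)

end BergmanIntegral

/-! ### Reproducing kernels -/

section Kernel

variable {ℓ : ℕ}

/-- The reproducing kernel of the weighted Bergman space, as a function on `ℂ`. -/
noncomputable def kernelFun (ℓ : ℕ) (w z : ℂ) : ℂ := (2 ^ ℓ * (ℓ + 1)) / (z + conj w) ^ (ℓ + 2)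

lemma kernelFun_cayley (ℓ : ℕ) {w ζ : ℂ} (hζ : ζ ∈ ball (0 : ℂ) 1) :
    kernelFun ℓ w (cayley w ζ) =
      ((2 ^ ℓ * (ℓ + 1) / (2 * w.re) ^ (ℓ + 2) : ℝ) : ℂ) * (1 - ζ) ^ (ℓ + 2) := by
  rw [kernelFun, cayley_add_conj w hζ, div_pow]
  push_cast
  rw [div_div_eq_mul_div, div_mul_eq_mul_div]

lemma differentiableOn_kernelFun (ℓ : ℕ) {w : ℂ} (hw : 0 < w.re) :
    DifferentiableOn ℂ (kernelFun ℓ w) {z : ℂ | 0 < z.re} := fun _ hz =>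
  (DifferentiableAt.fun_div (d := fun z => (z + conj w) ^ (ℓ + 2)) (differentiableAt_const _)
    ((differentiableAt_id.add_const (conj w)).fun_pow _)
    (pow_ne_zero _ (add_conj_ne_zero hw hz))).differentiableWithinAt

lemma kernelFun_mem (ℓ : ℕ) (w : RHP) :
    (fun z : RHP => kernelFun ℓ w z) ∈ bergmanSubmodule ℓ := by
  have ha : IsAnalytic fun z : RHP => kernelFun ℓ w z :=
    (isAnalytic_iff_exists _).2 ⟨_, differentiableOn_kernelFun ℓ w.2, fun _ => rfl⟩
  refine ⟨ha, (memLp_two_iff_integrable_sq_norm ha.continuous.aestronglyMeasurable).2 ?_⟩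
  refine (integrable_bergmanMeasure_iff_ball (fun z => ‖kernelFun ℓ w z‖ ^ 2) w.2).2 ?_
  -- On the disk the factor |1 - ζ|^(2(ℓ+2)) of |K_w|² cancels the denominator of the density,
  -- leaving a function continuous up to the boundary.
  have hc : IntegrableOn (fun ζ : ℂ => 4 * (w : ℂ).re ^ (ℓ + 2) / Real.pi *
      (2 ^ ℓ * (ℓ + 1) / (2 * (w : ℂ).re) ^ (ℓ + 2)) ^ 2 * (1 - ‖ζ‖ ^ 2) ^ ℓ)
      (ball (0 : ℂ) 1) := by
    refine (ContinuousOn.integrableOn_compact (isCompact_closedBall (0 : ℂ) 1) ?_).mono_set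
      ball_subset_closedBall
    fun_prop
  refine hc.congr_fun (fun ζ hζ => ?_) measurableSet_ball
  have h1 := norm_ne_zero_iff.2 (one_sub_ne_zero_of_mem_ball hζ)
  simp only [smul_eq_mul]
  rw [kernelFun_cayley ℓ hζ, norm_mul, norm_pow, Complex.norm_real, mul_pow _ (_ ^ _) 2,
    Real.norm_eq_abs, sq_abs, ← pow_mul, mul_comm (ℓ + 2) 2]
  field_simp

/-- The reproducing kernel at the point `w`, as an element of the weighted Bergman space. -/
noncomputable def kernel (ℓ : ℕ) (w : RHP) : BergmanSpace ℓ :=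
  (⟨fun z => kernelFun ℓ w z, kernelFun_mem ℓ w⟩ : bergmanSubmodule ℓ)

lemma kernel_apply (w z : RHP) : kernel ℓ w z = kernelFun ℓ w z := rfl

lemma inner_def (f g : BergmanSpace ℓ) :
    inner ℂ f g = ∫ z, conj (f z) * g z ∂bergmanMeasure ℓ := rfl

/-- The factor conj (1 - ζ)^(ℓ+2) of the conjugated kernel cancels half of |1 - ζ|^(2(ℓ+2)). What
remains is a radial weight times a holomorphic function whenever a is holomorphic in ζ, so the mean
value property applies. -/
lemma kernel_weight_cayley (ℓ : ℕ) {w ζ : ℂ} (hw : 0 < w.re) (hζ : ζ ∈ ball (0 : ℂ) 1) (a : ℂ) :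
    (4 * w.re ^ (ℓ + 2) / Real.pi * ((1 - ‖ζ‖ ^ 2) ^ ℓ / ‖1 - ζ‖ ^ (2 * (ℓ + 2)))) •
      (conj (kernelFun ℓ w (cayley w ζ)) * a) =
    (((ℓ : ℝ) + 1) / Real.pi) • ((1 - ‖ζ‖ ^ 2) ^ ℓ • (a / (1 - ζ) ^ (ℓ + 2))) := by
  have h1 := one_sub_ne_zero_of_mem_ball hζ
  have h1' : conj (1 - ζ) ≠ 0 := (map_ne_zero _).2 h1
  have h2 : (w.re : ℂ) ≠ 0 := Complex.ofReal_ne_zero.2 hw.ne'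
  have h3 : (Real.pi : ℂ) ≠ 0 := Complex.ofReal_ne_zero.2 Real.pi_ne_zero
  have h4 : ((‖1 - ζ‖ ^ (2 * (ℓ + 2)) : ℝ) : ℂ) = (1 - ζ) ^ (ℓ + 2) * conj (1 - ζ) ^ (ℓ + 2) := by
    rw [← mul_pow, Complex.mul_conj', pow_mul]
    push_cast
    rfl
  rw [kernelFun_cayley ℓ hζ, map_mul, Complex.conj_ofReal, map_pow]
  simp only [Complex.real_smul]
  rw [Complex.ofReal_mul, Complex.ofReal_div ((1 - ‖ζ‖ ^ 2) ^ ℓ), h4]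
  push_cast
  -- The identity is rational in 1 - ζ and its conjugate, treated as independent variables.
  generalize conj (1 - ζ) = b at *
  generalize (1 - ζ) = c at *
  field_simp
  ring

/-- The reproducing property. -/
theorem inner_kernel (w : RHP) (f : BergmanSpace ℓ) : inner ℂ (kernel ℓ w) f = f w := by
  obtain ⟨F, hF, hFf⟩ := (isAnalytic_iff_exists _).1 f.coe_mem.1
  set G : ℂ → ℂ := fun ζ => F (cayley w ζ) / (1 - ζ) ^ (ℓ + 2) with hG
  have hGd : DifferentiableOn ℂ G (ball 0 1) := by
    refine DifferentiableOn.fun_div (hF.comp (differentiableOn_cayley w)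
      fun ζ hζ => re_cayley_pos w.2 hζ) (by fun_prop) fun ζ hζ =>
        pow_ne_zero _ (one_sub_ne_zero_of_mem_ball hζ)
  have hcongr : ∀ z : RHP, conj (kernel ℓ w z) * f z = conj (kernelFun ℓ w z) * F z := fun z => by
    rw [hFf, kernel_apply]
  have hi := BergmanSpace.integrable_conj_mul (kernel ℓ w) f
  have hpos : ((ℓ : ℝ) + 1) / Real.pi ≠ 0 := div_ne_zero (Nat.cast_add_one_ne_zero ℓ) Real.pi_ne_zero
  rw [inner_def]
  simp_rw [hcongr] at hi ⊢
  rw [integrable_bergmanMeasure_iff_ball (fun z => conj (kernelFun ℓ w z) * F z) w.2] at hi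
  rw [integral_bergmanMeasure_eq_ball (fun z => conj (kernelFun ℓ w z) * F z) w.2,
    setIntegral_congr_fun measurableSet_ball fun ζ hζ => kernel_weight_cayley ℓ w.2 hζ _,
    integral_smul, setIntegral_ball_one_sub_sq_pow_smul ℓ hGd, smul_smul, hG]
  · have : ((ℓ : ℝ) + 1) / Real.pi * (Real.pi / (ℓ + 1)) = 1 := by
      have := Real.pi_ne_zero
      field_simp
    rw [this]
    simp [cayley_zero, hFf]
  · have h := (integrableOn_congr_fun
      (fun ζ hζ => kernel_weight_cayley ℓ w.2 hζ _) measurableSet_ball).1 hi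
    exact (integrable_smul_iff hpos _).1 h

lemma kernel_ne_zero (w : RHP) : kernel ℓ w ≠ 0 := fun h => by
  have h1 : kernel ℓ w w = 0 := by rw [h]; rfl
  rw [kernel_apply, kernelFun] at h1
  refine div_ne_zero ?_ (pow_ne_zero _ (add_conj_ne_zero w.2 w.2)) h1
  exact mul_ne_zero (pow_ne_zero _ two_ne_zero) (Nat.cast_add_one_ne_zero ℓ)

lemma BergmanSpace.eq_zero_of_const {f : BergmanSpace ℓ} {c : ℂ} (hf : ∀ z : RHP, f z = c) :
    f = 0 := by
  by_contra h
  have hc : c ≠ 0 := fun hc => h (coe_injective (funext fun z => by rw [hf z, hc]; rfl))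
  exact not_memLp_of_le_norm one_pos (norm_pos_iff.2 hc) (fun z _ => by rw [hf z]) f.coe_mem.2

end Kernel

end HalfPlane

namespace HalfPlane

open Metric Set Filter Topology

/-! ### Invariant functions near an attracting fixed point -/

section Dynamics

/-- A function invariant under composition with a self-map that has an attracting fixed point is
constant. -/
lemma eq_of_comp_eq_of_norm_deriv_lt_one {U : Set ℂ} (hU : IsOpen U) (hUc : IsPreconnected U)
    {g h : ℂ → ℂ} {α g' : ℂ} (hα : α ∈ U) (hgα : g α = α) (hg : HasDerivAt g g' α)
    (hg' : ‖g'‖ < 1) (hh : DifferentiableOn ℂ h U) (hcomp : ∀ z ∈ U, h (g z) = h z) :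
    ∀ z ∈ U, h z = h α := by
  obtain ⟨q, hq1, hq2⟩ := exists_between hg'
  have hq0 : 0 ≤ q := (norm_nonneg _).trans hq1.le
  -- The gap q - ‖g'‖ absorbs the little-o error of the derivative, so g contracts towards α by the
  -- factor q.
  have hlip : ∀ᶠ z in 𝓝 α, ‖g z - α‖ ≤ q * ‖z - α‖ := by
    filter_upwards [hg.isLittleO.def (sub_pos.2 hq1)] with z hz
    rw [hgα, smul_eq_mul] at hz
    calc ‖g z - α‖ = ‖(g z - α - (z - α) * g') + (z - α) * g'‖ := by ring_nf
      _ ≤ (q - ‖g'‖) * ‖z - α‖ + ‖z - α‖ * ‖g'‖ := (norm_add_le _ _).trans (by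
          rw [norm_mul]
          gcongr)
      _ = q * ‖z - α‖ := by ring
  obtain ⟨ρ, hρ, hball⟩ := Metric.mem_nhds_iff.1 (hlip.and (hU.mem_nhds hα))
  have hcont : ContinuousAt h α := hh.continuousOn.continuousAt (hU.mem_nhds hα)
  have hloc : ∀ z ∈ ball α ρ, h z = h α := by
    intro z hz
    have hiter : ∀ n : ℕ, g^[n] z ∈ ball α ρ ∧ ‖g^[n] z - α‖ ≤ q ^ n * ‖z - α‖ ∧
        h (g^[n] z) = h z := by
      intro n
      induction n with
      | zero => simpa using hz
      | succ n ih =>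
        obtain ⟨h1, h2, h3⟩ := ih
        obtain ⟨h4, h5⟩ := hball h1
        rw [Function.iterate_succ_apply']
        refine ⟨?_, ?_, by rw [hcomp _ h5, h3]⟩
        · rw [mem_ball_iff_norm] at h1 ⊢
          exact (h4.trans (mul_le_of_le_one_left (norm_nonneg _) hq2.le)).trans_lt h1
        · calc _ ≤ q * ‖g^[n] z - α‖ := h4
            _ ≤ q * (q ^ n * ‖z - α‖) := by gcongr
            _ = _ := by ring
    have hlim : Tendsto (fun n => g^[n] z) atTop (𝓝 α) := by
      rw [tendsto_iff_norm_sub_tendsto_zero]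
      refine squeeze_zero (fun _ => norm_nonneg _) (fun n => (hiter n).2.1) ?_
      simpa using (tendsto_pow_atTop_nhds_zero_of_lt_one hq0 hq2).mul_const ‖z - α‖
    refine tendsto_nhds_unique ?_ (hcont.tendsto.comp hlim)
    simp only [Function.comp_def, (hiter _).2.2]
    exact tendsto_const_nhds
  exact (hh.analyticOnNhd hU).eqOn_of_preconnected_of_eventuallyEq analyticOnNhd_const hUc hα
    (Filter.eventually_of_mem (ball_mem_nhds α hρ) hloc)

lemma halfPlane_isOpen : IsOpen {z : ℂ | 0 < z.re} :=
  isOpen_lt continuous_const Complex.continuous_re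

lemma halfPlane_isPreconnected : IsPreconnected {z : ℂ | 0 < z.re} :=
  (convex_halfSpace_re_gt 0).isPreconnected

lemma BergmanSpace.eq_zero_of_comp_affine_eq {ℓ : ℕ} {f : BergmanSpace ℓ} {g : RHP → RHP}
    {a b : ℂ} (ha : ‖a‖ < 1) (hg : ∀ z : RHP, (g z : ℂ) = a * z + b) {α : RHP} (hα : g α = α)
    (hf : ∀ z, f (g z) = f z) : f = 0 := by
  obtain ⟨F, hF, hFf⟩ := (isAnalytic_iff_exists _).1 f.coe_mem.1
  refine eq_zero_of_const (c := F α) fun z => ?_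
  rw [← hFf]
  refine eq_of_comp_eq_of_norm_deriv_lt_one (g := fun z => a * z + b) (g' := a) halfPlane_isOpen
    halfPlane_isPreconnected α.2 ?_ ?_ ha hF ?_ z z.2
  · rw [← hg, hα]
  · simpa using ((hasDerivAt_id' (α : ℂ)).const_mul a).add_const b
  · intro z hz
    rw [← hg ⟨z, hz⟩, hFf, hf, ← hFf]

end Dynamics

/-! ### Self-maps with an interior fixed point -/

section FixedPoint

variable {ℓ : ℕ} {g : RHP → RHP}

/-- The self-map `g` of the right half-plane read on the unit disk, with `α` moved to `0`. -/
noncomputable def diskMap (g : RHP → RHP) (α : RHP) (ζ : ℂ) : ℂ :=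
  cayleyInv α (Function.extend Subtype.val (fun w => (g w : ℂ)) 0 (cayley α ζ))

lemma diskMap_apply (α : RHP) {ζ : ℂ} (hζ : ζ ∈ ball (0 : ℂ) 1) :
    diskMap g α ζ = cayleyInv α (g ⟨cayley α ζ, re_cayley_pos α.2 hζ⟩) :=
  congrArg (cayleyInv α)
    (extend_apply (fun w => (g w : ℂ)) ⟨cayley α ζ, re_cayley_pos α.2 hζ⟩)

lemma mapsTo_diskMap (α : RHP) : MapsTo (diskMap g α) (ball 0 1) (ball 0 1) := fun ζ hζ => by
  rw [diskMap_apply α hζ]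
  exact cayleyInv_mem_ball α.2 (g _).2

lemma cayley_diskMap (α : RHP) {ζ : ℂ} (hζ : ζ ∈ ball (0 : ℂ) 1) :
    cayley α (diskMap g α ζ) = g ⟨cayley α ζ, re_cayley_pos α.2 hζ⟩ := by
  rw [diskMap_apply α hζ, cayley_cayleyInv α.2 (g _).2]

lemma cayley_diskMap_cayleyInv (α z : RHP) :
    cayley α (diskMap g α (cayleyInv α z)) = g z := by
  rw [cayley_diskMap α (cayleyInv_mem_ball α.2 z.2)]
  simp only [cayley_cayleyInv α.2 z.2]

lemma differentiableOn_diskMap (hg : IsAnalytic fun w => (g w : ℂ)) (α : RHP) :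
    DifferentiableOn ℂ (diskMap g α) (ball 0 1) := by
  refine (differentiableOn_cayleyInv α.2).comp
    (DifferentiableOn.comp hg (differentiableOn_cayley α) fun ζ hζ => re_cayley_pos α.2 hζ)
    fun ζ hζ => ?_
  have h := extend_apply (fun w => (g w : ℂ)) ⟨cayley α ζ, re_cayley_pos α.2 hζ⟩
  exact (g _).2.trans_eq (congrArg Complex.re h).symm

lemma diskMap_zero {α : RHP} (hα : g α = α) : diskMap g α 0 = 0 := by
  rw [diskMap_apply α (by simp)]
  simp only [cayley_zero, Subtype.coe_eta, hα, cayleyInv_self]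

lemma BergmanSpace.eq_zero_of_comp_eq {f : BergmanSpace ℓ} (hg : IsAnalytic fun w => (g w : ℂ))
    {α : RHP} (hα : g α = α) (hd : ‖deriv (diskMap g α) 0‖ < 1) (hf : ∀ z, f (g z) = f z) :
    f = 0 := by
  obtain ⟨F, hF, hFf⟩ := (isAnalytic_iff_exists _).1 f.coe_mem.1
  refine eq_zero_of_const (c := F (cayley α 0)) fun z => ?_
  have h := eq_of_comp_eq_of_norm_deriv_lt_one (g := diskMap g α) (h := fun ζ => F (cayley α ζ))
    isOpen_ball (convex_ball (0 : ℂ) 1).isPreconnected (mem_ball_self one_pos) (diskMap_zero hα)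
    ((differentiableOn_diskMap hg α).differentiableAt
      (ball_mem_nhds _ one_pos)).hasDerivAt hd
    (hF.comp (differentiableOn_cayley α) fun ζ hζ => re_cayley_pos α.2 hζ) (fun ζ hζ => ?_)
    (cayleyInv α z) (cayleyInv_mem_ball α.2 z.2)
  · simp only [cayley_cayleyInv α.2 z.2] at h
    rw [← hFf, h]
  · simp only [cayley_diskMap α hζ]
    rw [hFf, hf, ← hFf]

/-- A nontrivial rotation about an interior point does not induce an everywhere defined
composition operator. -/
lemma kernel_comp_not_mem_of_diskMap_eq_mul {α : RHP} (hne : g ≠ id) {c : ℂ} (hc : ‖c‖ = 1)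
    (hgc : ∀ ζ ∈ ball (0 : ℂ) 1, diskMap g α ζ = c * ζ) :
    (fun z => kernel ℓ α (g z)) ∉ bergmanSubmodule ℓ := by
  have hgz : ∀ z : RHP, (g z : ℂ) = cayley α (c * cayleyInv α z) := fun z => by
    rw [← hgc _ (cayleyInv_mem_ball α.2 z.2), cayley_diskMap_cayleyInv]
  have hc1 : 1 - c ≠ 0 := fun h => hne (funext fun z => Subtype.ext (by
    rw [hgz, ← sub_eq_zero.1 h, one_mul, cayley_cayleyInv α.2 z.2, id]))
  have hδ : 0 < ‖1 - c‖ := norm_pos_iff.2 hc1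
  have hα := α.2
  -- Since 1 - ζ = 2 Re α / (z + conj α), Re z beyond this threshold forces |1 - ζ| ≤ |1 - c| / 2.
  have hR : 0 < 4 * (α : ℂ).re / ‖1 - c‖ := by positivity
  set A : ℝ := 2 ^ ℓ * (ℓ + 1) / (2 * (α : ℂ).re) ^ (ℓ + 2) with hA
  have hA0 : 0 < A := by positivity
  refine fun hmem => not_memLp_of_le_norm (ε := A * (‖1 - c‖ / 2) ^ (ℓ + 2)) hR (by positivity)
    (fun z hz => ?_) hmem.2
  have hζ := cayleyInv_mem_ball hα z.2
  have hcζ : c * cayleyInv α z ∈ ball (0 : ℂ) 1 := by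
    rwa [mem_ball_zero_iff, norm_mul, hc, one_mul, ← mem_ball_zero_iff]
  have h1 : ‖1 - cayleyInv α z‖ ≤ ‖1 - c‖ / 2 := by
    have h2 : 1 - cayleyInv α z = (2 * (α : ℂ).re : ℝ) / ((z : ℂ) + conj (α : ℂ)) := by
      have := add_conj_ne_zero hα z.2
      rw [cayleyInv, ← Complex.add_conj]
      field_simp
      ring
    have h3 : 4 * (α : ℂ).re / ‖1 - c‖ ≤ ‖(z : ℂ) + conj (α : ℂ)‖ := by
      refine le_trans ?_ (Complex.re_le_norm _)
      simp
      linarith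
    have h4 := hR.trans_le h3
    rw [h2, norm_div, Complex.norm_real, Real.norm_of_nonneg (by positivity), div_le_iff₀ h4]
    rw [div_le_iff₀ hδ] at h3
    linarith
  -- Near infinity ζ is close to 1, so cζ is close to c ≠ 1, and K_α ∘ g = A (1 - cζ)^(ℓ+2) stays
  -- away from 0.
  have h5 : ‖1 - c‖ / 2 ≤ ‖1 - c * cayleyInv α z‖ := by
    have h6 : (1 - c) = (1 - c * cayleyInv α z) - c * (1 - cayleyInv α z) := by ring
    have h7 := norm_sub_le (1 - c * cayleyInv α z) (c * (1 - cayleyInv α z))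
    rw [← h6, norm_mul, hc, one_mul] at h7
    linarith
  rw [kernel_apply, hgz, kernelFun_cayley ℓ hcζ, norm_mul, norm_pow, Complex.norm_real,
    Real.norm_of_nonneg hA0.le]
  gcongr

end FixedPoint

/-! ### Kernels, adjoints and complex symmetry -/

section ComplexSymmetry

variable {ℓ : ℕ} {g : RHP → RHP}

lemma mem_graph_iff_comp_eq (f k : BergmanSpace ℓ) :
    (f, k) ∈ (maxCompositionOperator ℓ g).graph ↔ ∀ z, f (g z) = k z := by
  rw [LinearPMap.mem_graph_iff]
  constructor
  · rintro ⟨y, rfl, hy⟩ z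
    rw [← maxCompositionOperator_apply, hy]
  · intro h
    have hm : f ∈ (maxCompositionOperator ℓ g).domain := by
      rw [mem_maxCompositionOperator_domain, funext h]
      exact k.coe_mem
    exact ⟨⟨f, hm⟩, rfl, BergmanSpace.coe_injective (funext h)⟩

lemma inner_kernel_right (w : RHP) (f : BergmanSpace ℓ) :
    inner ℂ f (kernel ℓ w) = conj (f w) := by
  rw [← inner_conj_symm, inner_kernel]

/-- Pairing f ∘ g with K_w and f with K_{g(w)} both evaluate f at g(w); this is B* K_w = K_{g(w)}.
-/
lemma kernel_mem_graph_adjoint (w : RHP) :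
    (kernel ℓ w, kernel ℓ (g w)) ∈ (maxCompositionOperator ℓ g).graph.adjoint := by
  rw [Submodule.mem_adjoint_iff]
  intro f k hfk
  rw [mem_graph_iff_comp_eq] at hfk
  rw [inner_kernel_right, inner_kernel_right, hfk, sub_self]

lemma conjugation_kernel_ne_zero {C : BergmanSpace ℓ →ₗᵢ⋆[ℂ] BergmanSpace ℓ} (w : RHP) :
    C (kernel ℓ w) ≠ 0 := fun h => kernel_ne_zero w (C.injective (h.trans C.map_zero.symm))

/-- If `B = C B* C` for a composition operator whose symbol fixes `α`, then `C K_α` is invariant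
under composition with the symbol. -/
lemma conjugation_kernel_comp_eq {C : BergmanSpace ℓ →ₗᵢ⋆[ℂ] BergmanSpace ℓ}
    (hC : IsConjugation C) (hB : IsComplexSymmetricWith C (maxCompositionOperator ℓ g)) {α : RHP}
    (hα : g α = α) (z : RHP) : C (kernel ℓ α) (g z) = C (kernel ℓ α) z := by
  refine (mem_graph_iff_comp_eq _ _).1 ((hB _ _).2 ?_) z
  rw [hC]
  nth_rw 2 [← hα]
  exact kernel_mem_graph_adjoint α

theorem not_isComplexSymmetric_of_fixedPoint (hg : IsAnalytic fun w => (g w : ℂ))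
    (hb : (maxCompositionOperator ℓ g).domain = ⊤) (hne : g ≠ id) {α : RHP} (hα : g α = α) :
    ¬ IsComplexSymmetric (maxCompositionOperator ℓ g) := by
  rintro ⟨C, hC, hB⟩
  have hdiff := differentiableOn_diskMap hg α
  have hmaps : MapsTo (diskMap g α) (ball 0 1) (closedBall (diskMap g α 0) 1) := by
    rw [diskMap_zero hα]
    exact (mapsTo_diskMap α).mono_right ball_subset_closedBall
  -- Schwarz dichotomy at 0: an attracting fixed point, or equality and hence a rotation.
  rcases (Complex.norm_deriv_le_one_of_mapsTo_ball hdiff hmaps one_pos).lt_or_eq with hd | hd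
  · exact conjugation_kernel_ne_zero α
      (BergmanSpace.eq_zero_of_comp_eq hg hα hd (conjugation_kernel_comp_eq hC hB hα))
  · have haff := Complex.affine_of_mapsTo_ball_of_norm_dslope_eq_div hdiff hmaps
      (mem_ball_self one_pos) (by rw [dslope_same, hd, div_one])
    refine kernel_comp_not_mem_of_diskMap_eq_mul (ℓ := ℓ) (α := α) hne hd (fun ζ hζ => ?_)
      (mem_maxCompositionOperator_domain.1 (hb ▸ Submodule.mem_top))
    rw [haff hζ]
    simp only [diskMap_zero hα, dslope_same, smul_eq_mul]
    ring

/-- The symbol of the adjoint of the composition operator with symbol `w ↦ μ w + w₀`, up to a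
scalar factor. -/
noncomputable def adjointSymbol {μ : ℝ} {w₀ : ℂ} (hμ : 0 < μ) (hw₀ : 0 < w₀.re) (w : RHP) : RHP :=
  ⟨((μ⁻¹ : ℝ) : ℂ) * w + ((μ⁻¹ : ℝ) : ℂ) * conj w₀, by
    rw [Complex.add_re, Complex.re_ofReal_mul, Complex.re_ofReal_mul, Complex.conj_re]
    have := w.2
    positivity⟩

/-- Factoring μ out of μ z + w₀ + conj w leaves z + conj σ(w), so composition with g sends kernels
to multiples of kernels. -/
lemma kernel_comp_affine {μ : ℝ} {w₀ : ℂ} (hμ : 0 < μ) (hw₀ : 0 < w₀.re)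
    (hg : ∀ w : RHP, (g w : ℂ) = μ * (w : ℂ) + w₀) (w z : RHP) :
    kernel ℓ w (g z) = (((μ⁻¹ : ℝ) : ℂ) ^ (ℓ + 2) • kernel ℓ (adjointSymbol hμ hw₀ w)) z := by
  have h1 : (μ : ℂ) ≠ 0 := Complex.ofReal_ne_zero.2 hμ.ne'
  have h2 : (g z : ℂ) + conj (w : ℂ) =
      μ * ((z : ℂ) + conj (adjointSymbol hμ hw₀ w : ℂ)) := by
    rw [hg, adjointSymbol]
    simp only [map_add, map_mul, Complex.conj_ofReal, Complex.conj_conj]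
    push_cast
    field_simp
    ring
  rw [map_smul, Pi.smul_apply, kernel_apply, kernel_apply, kernelFun, kernelFun, h2, mul_pow,
    smul_eq_mul]
  push_cast
  rw [inv_pow, div_mul_eq_div_div, div_right_comm, div_eq_inv_mul]

theorem not_isComplexSymmetric_of_affine {μ : ℝ} {w₀ : ℂ} (hμ : 0 < μ) (hμ1 : μ ≠ 1)
    (hw₀ : 0 < w₀.re) (hg : ∀ w : RHP, (g w : ℂ) = μ * (w : ℂ) + w₀) :
    ¬ IsComplexSymmetric (maxCompositionOperator ℓ g) := by
  rintro ⟨C, hC, hB⟩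
  rcases hμ1.lt_or_gt with h1 | h1
  -- For μ < 1 the fixed point of g is w₀ / (1 - μ), with multiplier μ.
  · have hα : 0 < ((((1 - μ)⁻¹ : ℝ) : ℂ) * w₀).re := by
      rw [Complex.re_ofReal_mul]
      exact mul_pos (inv_pos.2 (sub_pos.2 h1)) hw₀
    set α : RHP := ⟨_, hα⟩ with hαdef
    have hfix : g α = α := Subtype.ext (by
      have : (1 - μ : ℂ) ≠ 0 := by exact_mod_cast (sub_pos.2 h1).ne'
      rw [hg, hαdef]
      push_cast
      field_simp
      ring)
    refine conjugation_kernel_ne_zero α (BergmanSpace.eq_zero_of_comp_affine_eq ?_ hg hfix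
      (conjugation_kernel_comp_eq hC hB hfix))
    rwa [Complex.norm_real, Real.norm_of_nonneg hμ.le]
  -- For μ > 1 the fixed point of g lies outside the half-plane; that of σ is conj w₀ / (μ - 1),
  -- with multiplier 1/μ.
  · have hβ : 0 < ((((μ - 1)⁻¹ : ℝ) : ℂ) * conj w₀).re := by
      rw [Complex.re_ofReal_mul, Complex.conj_re]
      exact mul_pos (inv_pos.2 (sub_pos.2 h1)) hw₀
    set β : RHP := ⟨_, hβ⟩ with hβdef
    have hfix : adjointSymbol hμ hw₀ β = β := Subtype.ext (by
      have hμ0 : (μ : ℂ) ≠ 0 := Complex.ofReal_ne_zero.2 hμ.ne'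
      have : (μ - 1 : ℂ) ≠ 0 := by exact_mod_cast (sub_pos.2 h1).ne'
      rw [adjointSymbol, hβdef]
      push_cast
      field_simp
      ring)
    have hker : ∀ w : RHP, (kernel ℓ w, ((μ⁻¹ : ℝ) : ℂ) ^ (ℓ + 2) •
        kernel ℓ (adjointSymbol hμ hw₀ w)) ∈ (maxCompositionOperator ℓ g).graph := fun w =>
      (mem_graph_iff_comp_eq _ _).2 (kernel_comp_affine hμ hw₀ hg w)
    have hadj := (hB _ _).1 (hker β)
    rw [hfix, Submodule.mem_adjoint_iff] at hadj
    refine conjugation_kernel_ne_zero (C := C) β (BergmanSpace.eq_zero_of_comp_affine_eq ?_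
      (fun _ => rfl) hfix fun z => ?_)
    · rw [Complex.norm_real, Real.norm_of_nonneg (inv_pos.2 hμ).le]
      exact inv_lt_one_of_one_lt₀ h1
    -- Testing the adjoint relation on K_z evaluates C K_β at σ(z) and at z; the same nonzero factor
    -- μ^(-(ℓ+2)) appears on both sides and cancels.
    · have h := sub_eq_zero.1 (hadj _ _ (hker z))
      rw [LinearIsometry.map_smulₛₗ, inner_smul_left, inner_smul_right, inner_kernel,
        inner_kernel] at h
      simpa [hμ.ne'] using h

end ComplexSymmetry

end HalfPlane

theorem theorem7 (ℓ : ℕ) :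
    (∀ g : HalfPlane.RHP → HalfPlane.RHP,
      HalfPlane.IsAnalytic (fun w => (g w : ℂ)) →
      HalfPlane.IsBoundedOn (HalfPlane.maxCompositionOperator ℓ g) →
      g ≠ id →
      (∃ α : HalfPlane.RHP, g α = α) →
      ¬ HalfPlane.IsComplexSymmetric (HalfPlane.maxCompositionOperator ℓ g)) ∧
    (∀ (μ : ℝ) (w₀ : ℂ), 0 < μ → μ ≠ 1 → 0 < w₀.re →
      ∀ g : HalfPlane.RHP → HalfPlane.RHP,
        (∀ w : HalfPlane.RHP, (g w : ℂ) = μ * (w : ℂ) + w₀) →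
        ¬ HalfPlane.IsComplexSymmetric (HalfPlane.maxCompositionOperator ℓ g)) := by
  refine ⟨fun g hg hb hne ⟨α, hα⟩ => ?_, fun μ w₀ hμ hμ1 hw₀ g hg => ?_⟩
  · exact HalfPlane.not_isComplexSymmetric_of_fixedPoint hg hb.1 hne hα
  · exact HalfPlane.not_isComplexSymmetric_of_affine hμ hμ1 hw₀ hg
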